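/- Let $n,m\ge 1$ be integers and $0<\varepsilon<1/4$. Let $G$ be an arbitrary abelian group, let $Y\subseteq G$ be a subset with exactly $n$ elements, and let $$\beta=\max\{|H| : H\le G \text{ a finite subgroup with } |H|\le (1+4\varepsilon)m\}.$$ For $A,B\subseteq Y$ write $(A+B)^c=(Y+Y)\setminus(A+B)$. For $U_0\subseteq Y+Y$ and $U_1,U_2\subseteq Y$ let $\mathcal H(U_0,U_1,U_2)$ be the tripartite $3$-uniform hypergraph whose parts are (disjoint copies of) $U_0,U_1,U_2$ and in which $c\in U_0$, $a\in U_1$, $b\in U_2$ form an edge if and only if $c=a+b$; let $e(\cdot)$ denote the number of edges. Then there is a collection $\mathcal C\subseteq 2^{Y+Y}\times 2^Y\times 2^Y$ of at most $n^{2^7\varepsilon^{-2}\sqrt m}$ triples with the following properties. 1. For every pair $(A,B)$ of subsets of $Y$ with $|A|\ge\sqrt m$, $|B|\ge(1+\varepsilon^{-2})\sqrt m$ and $|A+B|\le m$ there is a triple $(C_0,C_1,C_2)\in\mathcal C$ with $(A+B)^c\subseteq C_0$, $A\subseteq C_1$ and $B\subseteq C_2$. 2. Every $(C_0,C_1,C_2)\in\mathcal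 C$ satisfies $|C_1|+|C_2|\le(1+2\varepsilon)(m+\beta)$. 3. Every $(C_0,C_1,C_2)\in\mathcal C$ satisfies $\max\{|C_1|,|C_2|\}\le m/4$ or $e(\mathcal H(C_0,C_1,C_2))<\varepsilon^2|C_1||C_2|$. -/

import Mathlib

open scoped Pointwise

/-- `betaG G x = max {|H| : H ≤ G a finite subgroup with |H| ≤ x}`, for a real number `x`.
(The set below is bounded, and it contains `1` as soon as `1 ≤ x`, so the supremum is a maximum:
see `isGreatest_betaG`.) -/
noncomputable def betaG (G : Type*) [AddCommGroup G] (x : ℝ) : ℕ :=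
  sSup {k : ℕ | (k : ℝ) ≤ x ∧ ∃ H : AddSubgroup G, Finite H ∧ Nat.card H = k}

theorem isGreatest_betaG (G : Type*) [AddCommGroup G] {x : ℝ} (hx : 1 ≤ x) :
    IsGreatest {k : ℕ | (k : ℝ) ≤ x ∧ ∃ H : AddSubgroup G, Finite H ∧ Nat.card H = k}
      (betaG G x) := by
  have hne : {k : ℕ | (k : ℝ) ≤ x ∧ ∃ H : AddSubgroup G, Finite H ∧ Nat.card H = k}.Nonempty :=
    ⟨1, by simpa using hx, ⊥, inferInstance, by simp⟩
  have hbdd : BddAbove {k : ℕ | (k : ℝ) ≤ x ∧ ∃ H : AddSubgroup G, Finite H ∧ Nat.card H = k} :=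
    ⟨⌊x⌋₊, fun k hk => Nat.le_floor hk.1⟩
  exact ⟨Nat.sSup_mem hne hbdd, fun k hk => le_csSup hbdd hk⟩

/-- The edge `{c, a, b}` of the tripartite hypergraph below: `c` is taken in the first copy of `G`,
`a` in the second and `b` in the third. -/
def tripleEdge {G : Type*} (c a b : G) : Set (G ⊕ G ⊕ G) :=
  {Sum.inl c, Sum.inr (Sum.inl a), Sum.inr (Sum.inr b)}

/-- The tripartite 3-uniform hypergraph `H(U₀, U₁, U₂)`. Its vertex set is the disjoint union of
the parts `U₀`, `U₁`, `U₂`, and its edges are the sets `{c, a, b}` with `c ∈ U₀`, `a ∈ U₁`,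
`b ∈ U₂` and `c = a + b`. -/
def sumHypergraph {G : Type*} [AddCommGroup G] (U₀ U₁ U₂ : Finset G) :
    Hypergraph (G ⊕ G ⊕ G) where
  vertexSet := Sum.inl '' (U₀ : Set G) ∪ (fun a => Sum.inr (Sum.inl a)) '' (U₁ : Set G) ∪
    (fun b => Sum.inr (Sum.inr b)) '' (U₂ : Set G)
  edgeSet := {e | ∃ c ∈ U₀, ∃ a ∈ U₁, ∃ b ∈ U₂, c = a + b ∧ e = tripleEdge c a b}
  subset_vertexSet_of_mem_edgeSet' := by
    rintro e ⟨c, hc, a, ha, b, hb, -, rfl⟩ v hv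
    simp only [tripleEdge, Set.mem_insert_iff, Set.mem_singleton_iff] at hv
    rcases hv with rfl | rfl | rfl
    · exact Or.inl (Or.inl ⟨c, hc, rfl⟩)
    · exact Or.inl (Or.inr ⟨a, ha, rfl⟩)
    · exact Or.inr ⟨b, hb, rfl⟩

/-- `e(H(U₀, U₁, U₂))`, the number of edges (a finite number, see
`sumHypergraphEdges_eq_card`). -/
noncomputable def sumHypergraphEdges {G : Type*} [AddCommGroup G] (U₀ U₁ U₂ : Finset G) : ℕ :=
  (sumHypergraph U₀ U₁ U₂).edgeSet.ncard

theorem sumHypergraphEdges_eq_card {G : Type*} [AddCommGroup G] [DecidableEq G]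
    (U₀ U₁ U₂ : Finset G) :
    sumHypergraphEdges U₀ U₁ U₂ = ((U₁ ×ˢ U₂).filter fun p => p.1 + p.2 ∈ U₀).card := by
  have himage : (sumHypergraph U₀ U₁ U₂).edgeSet =
      (fun p : G × G => tripleEdge (p.1 + p.2) p.1 p.2) ''
        (((U₁ ×ˢ U₂).filter fun p => p.1 + p.2 ∈ U₀ : Finset (G × G)) : Set (G × G)) := by
    ext e
    constructor
    · rintro ⟨c, hc, a, ha, b, hb, rfl, rfl⟩
      exact ⟨(a, b), by simp [ha, hb, hc], rfl⟩
    · rintro ⟨⟨a, b⟩, hp, rfl⟩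
      simp only [Finset.coe_filter, Finset.mem_product, Set.mem_ofPred_eq] at hp
      exact ⟨a + b, hp.2, a, hp.1.1, b, hp.1.2, rfl, rfl⟩
  have hinj : Function.Injective (fun p : G × G => tripleEdge (p.1 + p.2) p.1 p.2) := by
    rintro ⟨a, b⟩ ⟨a', b'⟩ h
    have h₁ : (Sum.inr (Sum.inl a) : G ⊕ G ⊕ G) ∈ tripleEdge (a' + b') a' b' := by
      rw [← show tripleEdge (a + b) a b = tripleEdge (a' + b') a' b' from h]
      simp [tripleEdge]
    have h₂ : (Sum.inr (Sum.inr b) : G ⊕ G ⊕ G) ∈ tripleEdge (a' + b') a' b' := by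
      rw [← show tripleEdge (a + b) a b = tripleEdge (a' + b') a' b' from h]
      simp [tripleEdge]
    simp [tripleEdge] at h₁ h₂
    rw [h₁, h₂]
  rw [sumHypergraphEdges, himage, Set.ncard_image_of_injective _ hinj, Set.ncard_coe_finset]

/-! The argument combines a container algorithm with a supersaturation estimate.

Supersaturation (`card_add_card_le_of_card_missingPairs_lt`): let `|D| ≤ m`. The truncated sum `∑ₓ
min(t, r(x))` is at most `t|D|` plus the number of pairs in `A × B` whose sum misses `D`. The
Pollard-type bound `le_truncSum`, proved by the Dyson transform with the subgroup obstruction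
measured by `β`, makes this sum much larger than `tm` once `|A| + |B| > (1 + 2ε)(m + β)`. Hence at
least `ε²|A||B|` pairs miss `D`, and every sparse container has the required size.

Containers (`isCoverable_isCompatible`): a triple `(D, U, V)` with `D ⊆ A + B`, `A ⊆ U`, `B ⊆ V` is
refined until it is sparse or both `U` and `V` are small. A round (`isCoverable_round`) guesses the
`q` elements `F` of `A` of largest missing degree and removes from `U` whatever is thereby excluded.
If the triple is still dense, elements `b` of `B` that send many elements of `F` outside `D` are
guessed one at a time, and `b + F` is added to `D`. When none remains, `B` lies among the low-degree
elements of `V`. Since `|D| ≤ m`, there are few guesses of this kind, and each dense round lowers a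
potential of size `O(m)` by `ε²m/8` (`potential_drop`). With `q ≈ √m` the guesses have total
exponent `O(√m/ε²)`. The final containers are `((Y + Y) \ D, U, V)`. -/

/-- The number of representations of `x` as a sum of an element of `A` and an element of `B`. -/
def repCount {G : Type*} [AddCommGroup G] [DecidableEq G] (A B : Finset G) (x : G) : ℕ :=
  (A.filter fun a => x - a ∈ B).card

/-! ### Pollard's inequality in abelian groups. -/

section Pollard

variable {G : Type*} [AddCommGroup G] [DecidableEq G]

/-- A representation with first term in `B \ A` and second in `A ∩ B` becomes one from `A × B` when
its terms are swapped. The sets `A × (A ∩ B)`, `(A ∩ B) × (B \ A)` and `(A \ B) × (B \ A)` are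
disjoint parts of `A × B`. -/
theorem repCount_union_inter_add_le (A B : Finset G) (x : G) :
    repCount (A ∪ B) (A ∩ B) x + repCount (A \ B) (B \ A) x ≤ repCount A B x := by
  have h₁ : repCount (A ∪ B) (A ∩ B) x ≤
      (A.filter fun a => x - a ∈ A ∩ B).card +
        ((A ∩ B).filter fun a => x - a ∈ B \ A).card := by
    have hinv : ((B \ A).filter fun a => x - a ∈ A ∩ B).card ≤
        ((A ∩ B).filter fun a => x - a ∈ B \ A).card := by
      refine Finset.card_le_card_of_injOn (fun a => x - a) ?_ (fun a _ b _ h => by simpa using h)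
      intro a ha
      simp only [Finset.coe_filter, Set.mem_ofPred_eq, sub_sub_cancel] at ha ⊢
      exact ⟨ha.2, ha.1⟩
    refine le_trans ?_ (Nat.add_le_add_left hinv _)
    refine le_trans (Finset.card_le_card ?_) (Finset.card_union_le _ _)
    intro a
    simp only [Finset.mem_filter, Finset.mem_union, Finset.mem_sdiff]
    tauto
  refine (Nat.add_le_add_right h₁ _).trans ?_
  rw [repCount, repCount, ← Finset.card_union_of_disjoint, ← Finset.card_union_of_disjoint]
  · refine Finset.card_le_card fun a => ?_
    simp only [Finset.mem_filter, Finset.mem_union, Finset.mem_sdiff, Finset.mem_inter]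
    tauto
  · rw [Finset.disjoint_left]
    intro a
    simp only [Finset.mem_filter, Finset.mem_union, Finset.mem_sdiff, Finset.mem_inter]
    tauto
  · rw [Finset.disjoint_left]
    intro a
    simp only [Finset.mem_filter, Finset.mem_sdiff, Finset.mem_inter]
    tauto

/-- The truncated representation sum `∑ₓ min(t, r(x))`. -/
def truncSum (t : ℕ) (A B : Finset G) : ℕ := ∑ x ∈ A + B, min t (repCount A B x)

theorem truncSum_translate (t : ℕ) (A B : Finset G) (g : G) :
    truncSum t A (B.image (· + g)) = truncSum t A B := by
  have himage : A + B.image (· + g) = (A + B).image (· + g) := by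
    ext x
    simp only [Finset.mem_add, Finset.mem_image]
    constructor
    · rintro ⟨a, ha, _, ⟨b, hb, rfl⟩, rfl⟩
      exact ⟨a + b, ⟨a, ha, b, hb, rfl⟩, by abel⟩
    · rintro ⟨_, ⟨a, ha, b, hb, rfl⟩, rfl⟩
      exact ⟨a, ha, b + g, ⟨b, hb, rfl⟩, by abel⟩
  rw [truncSum, himage, Finset.sum_image (fun a _ b _ h => by simpa using h)]
  refine Finset.sum_congr rfl fun x _ => ?_
  congr 1
  rw [repCount, repCount]
  congr 1
  refine Finset.filter_congr fun a _ => ?_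
  simp only [Finset.mem_image]
  constructor
  · rintro ⟨b, hb, h⟩
    have : x - a = b := by
      rw [eq_comm, ← sub_eq_zero] at h ⊢
      rw [← neg_eq_zero, ← h]; abel
    rwa [this]
  · intro h
    exact ⟨x - a, h, by abel⟩

theorem truncSum_mono {t : ℕ} {A B A' B' : Finset G} (hsub : A' + B' ⊆ A + B)
    (h : ∀ x, repCount A' B' x ≤ repCount A B x) : truncSum t A' B' ≤ truncSum t A B :=
  (Finset.sum_le_sum fun x _ => min_le_min le_rfl (h x)).trans
    (Finset.sum_le_sum_of_subset hsub)

theorem union_add_inter_subset_add (A B : Finset G) : (A ∪ B) + (A ∩ B) ⊆ A + B := by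
  intro x hx
  obtain ⟨a, ha, b, hb, rfl⟩ := Finset.mem_add.1 hx
  rw [Finset.mem_inter] at hb
  rcases Finset.mem_union.1 ha with ha | ha
  · exact Finset.add_mem_add ha hb.2
  · rw [add_comm a b]; exact Finset.add_mem_add hb.1 ha

theorem sum_repCount (A B Z : Finset G) (hZ : A + B ⊆ Z) :
    ∑ x ∈ Z, repCount A B x = A.card * B.card := by
  rw [← Finset.card_product, Finset.card_eq_sum_card_fiberwise (f := fun p => p.1 + p.2) (t := Z)]
  · refine Finset.sum_congr rfl fun x _ => ?_
    rw [repCount]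
    refine Finset.card_bij' (fun a _ => (a, x - a)) (fun p _ => p.1) ?_ ?_ ?_ ?_
    · intro a ha; simpa using ha
    · rintro ⟨a, b⟩ h
      simp only [Finset.mem_filter, Finset.mem_product] at h ⊢
      obtain ⟨⟨ha, hb⟩, rfl⟩ := h
      simpa using ⟨ha, hb⟩
    · intro a _; rfl
    · rintro ⟨a, b⟩ h
      simp only [Finset.mem_filter] at h
      simp [← h.2]
  · rintro ⟨a, b⟩ h
    simp only [Finset.coe_product, Set.mem_prod, Finset.mem_coe] at h
    exact hZ (Finset.add_mem_add h.1 h.2)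

theorem repCount_le_card_right (A B : Finset G) (x : G) : repCount A B x ≤ B.card := by
  refine Finset.card_le_card_of_injOn (fun a => x - a) ?_ (fun a _ b _ h => by simpa using h)
  intro a ha
  simp only [Finset.coe_filter, Set.mem_ofPred_eq] at ha
  exact ha.2

theorem truncSum_add_le (A B : Finset G) (k l : ℕ) :
    truncSum k (A ∪ B) (A ∩ B) + truncSum l (A \ B) (B \ A) ≤ truncSum (k + l) A B := by
  have h₁ : truncSum k (A ∪ B) (A ∩ B) ≤ ∑ x ∈ A + B, min k (repCount (A ∪ B) (A ∩ B) x) :=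
    Finset.sum_le_sum_of_subset (union_add_inter_subset_add A B)
  have h₂ : truncSum l (A \ B) (B \ A) ≤ ∑ x ∈ A + B, min l (repCount (A \ B) (B \ A) x) :=
    Finset.sum_le_sum_of_subset (Finset.add_subset_add Finset.sdiff_subset Finset.sdiff_subset)
  refine (add_le_add h₁ h₂).trans ?_
  rw [← Finset.sum_add_distrib]
  refine Finset.sum_le_sum fun x _ => ?_
  have := repCount_union_inter_add_le A B x
  omega

/-- If `A` is stable under translation by the differences of `B`, then `|B|` is at most the order
of a finite subgroup which is itself at most `|A|`. -/
theorem exists_subgroup_of_stable {A B : Finset G} (hA : A.Nonempty) (hB : B.Nonempty)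
    (h : ∀ a ∈ A, ∀ b ∈ B, ∀ b' ∈ B, b' + (a - b) ∈ A) :
    ∃ H : AddSubgroup G, Finite H ∧ B.card ≤ Nat.card H ∧ Nat.card H ≤ A.card := by
  obtain ⟨a₀, ha₀⟩ := hA
  obtain ⟨b₀, hb₀⟩ := hB
  let H : AddSubgroup G := AddAction.stabilizer G A
  have hH : ∀ g : G, g ∈ H → g + a₀ ∈ A := fun g hg => by
    have hg' : g +ᵥ A = A := AddAction.mem_stabilizer_iff.1 hg
    rw [← hg']
    exact Finset.vadd_mem_vadd_finset ha₀
  let f : H → A := fun g => ⟨g.1 + a₀, hH g.1 g.2⟩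
  have hf : Function.Injective f := fun g g' e => by
    have := congrArg Subtype.val e
    exact Subtype.ext (by simpa [f] using this)
  have hfin : Finite H := Finite.of_injective f hf
  refine ⟨H, hfin, ?_, ?_⟩
  · have hmem : ∀ b ∈ B, b - b₀ ∈ H := fun b hb => by
      rw [AddAction.mem_stabilizer_iff]
      refine Finset.eq_of_subset_of_card_le ?_ (by simp)
      intro y hy
      obtain ⟨a, ha, rfl⟩ := Finset.mem_vadd_finset.1 hy
      have := h a ha b₀ hb₀ b hb
      rwa [show (b - b₀) +ᵥ a = b + (a - b₀) by rw [vadd_eq_add]; abel]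
    let e : B → H := fun b => ⟨b.1 - b₀, hmem b.1 b.2⟩
    have he : Function.Injective e := fun b b' hbb => by
      have := congrArg Subtype.val hbb
      exact Subtype.ext (by simpa [e] using this)
    simpa using Nat.card_le_card_of_injective e he
  · simpa using Nat.card_le_card_of_injective f hf

/-- Each element `a + b₀` of the translate `A + b₀` has `|B|` representations `(a + b₀ - b) + b`. -/
theorem mul_card_le_truncSum_of_stable {t : ℕ} {A B : Finset G} (hB : B.Nonempty)
    (ht : t ≤ B.card) (h : ∀ a ∈ A, ∀ b ∈ B, ∀ b' ∈ B, b' + (a - b) ∈ A) :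
    t * A.card ≤ truncSum t A B := by
  obtain ⟨b₀, hb₀⟩ := hB
  have hsub : A.image (· + b₀) ⊆ A + B := by
    intro x hx
    obtain ⟨a, ha, rfl⟩ := Finset.mem_image.1 hx
    exact Finset.add_mem_add ha hb₀
  refine le_trans ?_ (Finset.sum_le_sum_of_subset hsub)
  rw [Finset.sum_image (fun a _ b _ h => by simpa using h), mul_comm, ← smul_eq_mul]
  refine Finset.card_nsmul_le_sum _ _ _ fun a ha => ?_
  refine le_min le_rfl (ht.trans ?_)
  refine Finset.card_le_card_of_injOn (fun b => a + b₀ - b) ?_ (fun a _ b _ h => by simpa using h)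
  intro b hb
  simp only [Finset.coe_filter, Set.mem_ofPred_eq, sub_sub_cancel]
  refine ⟨?_, hb⟩
  have := h a ha b hb b₀ hb₀
  rwa [show a + b₀ - b = b₀ + (a - b) by abel]

/-- A Pollard-type inequality in abelian groups: if no finite subgroup has order strictly between
`α` and `τ`, then `∑ₓ min(t, r(x)) ≥ t min(τ, |A| + |B| - t - α + 1)`. -/
theorem le_truncSum {α : ℕ} (hα : 1 ≤ α) {τ : ℝ}
    (hτ : ∀ H : AddSubgroup G, Finite H → Nat.card H ≤ α ∨ τ ≤ (Nat.card H : ℝ)) (k : ℕ) :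
    ∀ (t : ℕ) (A B : Finset G), B.card ≤ k → t ≤ A.card → t ≤ B.card →
      (t : ℝ) * min τ ((A.card : ℝ) + B.card - t - α + 1) ≤ truncSum t A B := by
  have hα' : (1 : ℝ) ≤ α := by exact_mod_cast hα
  induction k with
  | zero =>
    intro t A B hk _ htB
    obtain rfl : t = 0 := by omega
    simp
  | succ k ih =>
    intro t A B hk htA htB
    rcases Nat.eq_zero_or_pos t with rfl | ht
    · simp
    have ht' : (1 : ℝ) ≤ t := by exact_mod_cast ht
    have hAne : A.Nonempty := Finset.card_pos.1 (by omega)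
    have hBne : B.Nonempty := Finset.card_pos.1 (by omega)
    by_cases h : ∀ a ∈ A, ∀ b ∈ B, ∀ b' ∈ B, b' + (a - b) ∈ A
    · have h₁ : ((t * A.card : ℕ) : ℝ) ≤ truncSum t A B := by
        exact_mod_cast mul_card_le_truncSum_of_stable hBne htB h
      refine le_trans ?_ h₁
      push_cast
      refine mul_le_mul_of_nonneg_left ?_ (by positivity)
      obtain ⟨H, hfin, hBH, hHA⟩ := exists_subgroup_of_stable hAne hBne h
      rcases hτ H hfin with hH | hH
      · refine (min_le_right _ _).trans ?_
        have : (B.card : ℝ) ≤ α := by exact_mod_cast hBH.trans hH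
        linarith
      · refine (min_le_left _ _).trans (hH.trans ?_)
        exact_mod_cast hHA
    · push Not at h
      obtain ⟨a, ha, b, hb, b', hb', hab⟩ := h
      rw [← truncSum_translate t A B (a - b)]
      have hinj : Function.Injective (fun x : G => x + (a - b)) := add_left_injective _
      have hcard : (B.image (· + (a - b))).card = B.card := Finset.card_image_of_injective _ hinj
      rw [← hcard] at hk htB ⊢
      have haB : a ∈ B.image (· + (a - b)) := Finset.mem_image.2 ⟨b, hb, by abel⟩
      have hbB : b' + (a - b) ∈ B.image (· + (a - b)) := Finset.mem_image.2 ⟨b', hb', rfl⟩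
      generalize B.image (· + (a - b)) = C at *
      -- The translate `C` of `B` meets `A` but is not contained in it, so both `A ∩ C` and `C \ A`
      -- are smaller than `C` and the induction applies to either transformed pair.
      have hpos : 0 < (A ∩ C).card := Finset.card_pos.2 ⟨a, Finset.mem_inter.2 ⟨ha, haB⟩⟩
      have hlt : (A ∩ C).card < C.card := by
        refine Finset.card_lt_card ⟨Finset.inter_subset_right, fun hs => hab ?_⟩
        exact (Finset.mem_inter.1 (hs hbB)).1
      have hui := Finset.card_union_add_card_inter A C
      have hAC := Finset.card_sdiff_add_card_inter A C
      have hCA := Finset.card_sdiff_add_card_inter C A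
      rw [Finset.inter_comm C A] at hCA
      have hAcard : (A ∩ C).card ≤ A.card := Finset.card_le_card Finset.inter_subset_left
      by_cases hti : t ≤ (A ∩ C).card
      · have h₁ := ih t (A ∪ C) (A ∩ C) (by omega) (by omega) hti
        have h₂ : truncSum t (A ∪ C) (A ∩ C) ≤ truncSum t A C :=
          truncSum_mono (union_add_inter_subset_add A C) fun x =>
            (Nat.le_add_right _ _).trans (repCount_union_inter_add_le A C x)
        have h₃ : ((A ∪ C).card : ℝ) + (A ∩ C).card = A.card + C.card := by exact_mod_cast hui
        rw [h₃] at h₁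
        exact h₁.trans (by exact_mod_cast h₂)
      · push Not at hti
        -- The level `t` is split as `|A ∩ C| + (l + 1)`. At level `|A ∩ C|` the truncation does
        -- nothing to the pair `(A ∪ C, A ∩ C)`, and the rest is left to `(A \ C, C \ A)`.
        obtain ⟨l, rfl⟩ := Nat.exists_eq_add_of_lt hti
        rw [show (A ∩ C).card + l + 1 = (A ∩ C).card + (l + 1) by ring] at *
        have h₁ := truncSum_add_le A C (A ∩ C).card (l + 1)
        have h₂ := ih (l + 1) (A \ C) (C \ A) (by omega) (by omega) (by omega)
        have h₃ : truncSum (A ∩ C).card (A ∪ C) (A ∩ C) = (A ∪ C).card * (A ∩ C).card := by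
          rw [truncSum, ← sum_repCount _ _ _ subset_rfl]
          exact Finset.sum_congr rfl fun x _ => min_eq_right (repCount_le_card_right _ _ _)
        rw [h₃] at h₁
        have h₁' : ((A ∪ C).card : ℝ) * (A ∩ C).card + truncSum (l + 1) (A \ C) (C \ A) ≤
            truncSum ((A ∩ C).card + (l + 1)) A C := by exact_mod_cast h₁
        refine le_trans ?_ h₁'
        refine le_trans ?_ (add_le_add_right h₂ _)
        have e₁ : ((A ∪ C).card : ℝ) = A.card + C.card - (A ∩ C).card := by
          rw [eq_sub_iff_add_eq]; exact_mod_cast hui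
        have e₂ : ((A \ C).card : ℝ) = A.card - (A ∩ C).card := by
          rw [eq_sub_iff_add_eq]; exact_mod_cast hAC
        have e₃ : ((C \ A).card : ℝ) = C.card - (A ∩ C).card := by
          rw [eq_sub_iff_add_eq]; exact_mod_cast hCA
        rw [e₁, e₂, e₃]
        push_cast
        have hl0 : (0 : ℝ) ≤ l := by positivity
        have hi0 : (0 : ℝ) ≤ (A ∩ C).card := by positivity
        generalize ((A ∩ C).card : ℝ) = i at *
        generalize (A.card : ℝ) = x at *
        generalize (C.card : ℝ) = y at *
        generalize (l : ℝ) = l at *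
        rcases le_total τ (x - i + (y - i) - (l + 1) - α + 1) with hc | hc
        · rw [min_eq_left hc]
          have h₄ : min τ (x + y - (i + (l + 1)) - α + 1) ≤ τ := min_le_left _ _
          have h₅ : min τ (x + y - (i + (l + 1)) - α + 1) ≤ x + y - i := 
            (min_le_right _ _).trans (by linarith)
          have := mul_le_mul_of_nonneg_right h₅ hi0
          have := mul_le_mul_of_nonneg_left h₄ (by linarith : (0 : ℝ) ≤ l + 1)
          linarith
        · rw [min_eq_right hc]
          have h₄ : min τ (x + y - (i + (l + 1)) - α + 1) ≤ x + y - (i + (l + 1)) - α + 1 :=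
            min_le_right _ _
          have := mul_le_mul_of_nonneg_left h₄ (by linarith : (0 : ℝ) ≤ i + (l + 1))
          -- The first pair gains `i(l + α)` over the target and the second loses `i(l + 1)`, which
          -- leaves this surplus.
          have : 0 ≤ i * (α - 1) := mul_nonneg hi0 (by linarith)
          linarith

end Pollard

/-! ### Supersaturation. -/

/-- The pairs in `A × B` whose sum lies outside `D`. -/
def missingPairs {G : Type*} [AddCommGroup G] [DecidableEq G] (D A B : Finset G) :
    Finset (G × G) :=
  (A ×ˢ B).filter fun p => p.1 + p.2 ∉ D

section Supersaturation

variable {G : Type*} [AddCommGroup G] [DecidableEq G]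

theorem card_missingPairs_comm (D A B : Finset G) :
    (missingPairs D A B).card = (missingPairs D B A).card := by
  refine Finset.card_bij' (fun p _ => p.swap) (fun p _ => p.swap) ?_ ?_ ?_ ?_
  · rintro ⟨a, b⟩ h
    simp only [missingPairs, Finset.mem_filter, Finset.mem_product, Prod.swap] at h ⊢
    rw [add_comm b a]; tauto
  · rintro ⟨a, b⟩ h
    simp only [missingPairs, Finset.mem_filter, Finset.mem_product, Prod.swap] at h ⊢
    rw [add_comm b a]; tauto
  · intros; rfl
  · intros; rfl

theorem card_pairs_add_mem_le (Z A B : Finset G) :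
    ((A ×ˢ B).filter fun p => p.1 + p.2 ∈ Z).card ≤ A.card * Z.card := by
  rw [← Finset.card_product]
  refine Finset.card_le_card_of_injOn (fun p => (p.1, p.1 + p.2)) ?_ ?_
  · rintro ⟨a, b⟩ h
    simp only [Finset.coe_filter, Finset.mem_product, Set.mem_ofPred_eq] at h
    simp [h.1.1, h.2]
  · rintro ⟨a, b⟩ - ⟨a', b'⟩ - h
    simp only [Prod.mk.injEq] at h
    obtain ⟨rfl, h⟩ := h
    simpa using h

theorem mul_card_le_card_missingPairs_add (D A B : Finset G) :
    A.card * B.card ≤ (missingPairs D A B).card + A.card * D.card := by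
  have h := Finset.card_filter_add_card_filter_not (s := A ×ˢ B) (fun p => p.1 + p.2 ∈ D)
  rw [Finset.card_product] at h
  have h' := card_pairs_add_mem_le D A B
  rw [missingPairs]
  omega

/-- A sum outside `D` is charged all its representations, a sum inside `D` at most `t`. -/
theorem truncSum_le_card_missingPairs_add (t : ℕ) (D A B : Finset G) :
    truncSum t A B ≤ (missingPairs D A B).card + t * D.card := by
  have h₁ : (missingPairs D A B).card = ∑ x ∈ (A + B) \ D, repCount A B x := by
    rw [missingPairs, Finset.card_eq_sum_card_fiberwise (f := fun p => p.1 + p.2)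
      (t := (A + B) \ D)]
    · refine Finset.sum_congr rfl fun x hx => ?_
      rw [repCount]
      refine Finset.card_bij' (fun p _ => p.1) (fun a _ => (a, x - a)) ?_ ?_ ?_ ?_
      · rintro ⟨a, b⟩ h
        simp only [Finset.mem_filter, Finset.mem_product] at h ⊢
        obtain ⟨⟨⟨ha, hb⟩, -⟩, rfl⟩ := h
        simpa using ⟨ha, hb⟩
      · intro a ha
        simpa [(Finset.mem_sdiff.1 hx).2] using ha
      · rintro ⟨a, b⟩ h
        simp only [Finset.mem_filter] at h
        simp [← h.2]
      · intro a _; rfl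
    · rintro ⟨a, b⟩ h
      simp only [Finset.coe_filter, Finset.mem_product, Set.mem_ofPred_eq] at h
      exact Finset.mem_coe.2 (Finset.mem_sdiff.2 ⟨Finset.add_mem_add h.1.1 h.1.2, h.2⟩)
  rw [h₁, truncSum, ← Finset.sum_inter_add_sum_sdiff (A + B) D, add_comm]
  refine add_le_add (Finset.sum_le_sum fun x _ => min_le_right _ _) ?_
  refine (Finset.sum_le_card_nsmul _ _ t fun x _ => min_le_left _ _).trans ?_
  rw [smul_eq_mul, mul_comm]
  exact Nat.mul_le_mul_left _ (Finset.card_le_card Finset.inter_subset_right)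

/-- Each `a ∈ A` has at most `|D|` partners whose sum lies in `D`. This keeps each set separately
not much larger than `m`. -/
theorem card_mul_lt_of_card_missingPairs_lt {m : ℕ} {δ : ℝ} {D A B : Finset G}
    (hD : D.card ≤ m) (h : ((missingPairs D A B).card : ℝ) < δ * A.card * B.card) :
    (1 - δ) * B.card < m := by
  have hA : (0 : ℝ) < A.card := by
    rcases A.eq_empty_or_nonempty with rfl | hA
    · simp [missingPairs] at h
    · exact_mod_cast hA.card_pos
  have h₁ : (A.card : ℝ) * B.card ≤ (missingPairs D A B).card + A.card * D.card := by
    exact_mod_cast mul_card_le_card_missingPairs_add D A B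
  have h₂ : (A.card : ℝ) * D.card ≤ A.card * m :=
    mul_le_mul_of_nonneg_left (by exact_mod_cast hD) hA.le
  have h₃ : (A.card : ℝ) * ((1 - δ) * B.card) < A.card * m := by linarith
  exact lt_of_mul_lt_mul_left h₃ hA.le

/-- Supersaturation: if few pairs in `A × B` have their sum outside a set of `m` elements, then
`|A| + |B|` is not much larger than `m + β`. -/
theorem card_add_card_le_of_card_missingPairs_lt {m : ℕ} (hm : 1 ≤ m) {ε : ℝ} (hε₀ : 0 < ε)
    (hε₁ : ε < 1 / 4) {D A B : Finset G} (hD : D.card ≤ m)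
    (h : ((missingPairs D A B).card : ℝ) < ε ^ 2 * A.card * B.card) :
    (A.card : ℝ) + B.card ≤ (1 + 2 * ε) * (m + betaG G ((1 + 4 * ε) * m)) := by
  by_contra! hcon
  have hm' : (1 : ℝ) ≤ m := by exact_mod_cast hm
  obtain ⟨-, hub⟩ := isGreatest_betaG G (x := (1 + 4 * ε) * m) (by nlinarith)
  have hβ : 1 ≤ betaG G ((1 + 4 * ε) * m) :=
    hub ⟨by push_cast; nlinarith, ⊥, inferInstance, by simp⟩
  have hτ : ∀ H : AddSubgroup G, Finite H → Nat.card H ≤ betaG G ((1 + 4 * ε) * m) ∨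
      (1 + 4 * ε) * m ≤ (Nat.card H : ℝ) := fun H hH => by
    rcases le_total (Nat.card H : ℝ) ((1 + 4 * ε) * m) with hc | hc
    · exact Or.inl (hub ⟨hc, H, hH, rfl⟩)
    · exact Or.inr hc
  generalize betaG G ((1 + 4 * ε) * m) = β at *
  have hB := card_mul_lt_of_card_missingPairs_lt hD h
  have hA : (1 - ε ^ 2) * A.card < m := by
    refine card_mul_lt_of_card_missingPairs_lt (A := B) hD ?_
    rw [card_missingPairs_comm]; linarith
  have hβ' : (1 : ℝ) ≤ β := by exact_mod_cast hβ
  have hsum : m + β < A.card + B.card := by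
    have : (m : ℝ) + β < A.card + B.card := by nlinarith
    exact_mod_cast this
  obtain ⟨d, hd⟩ := Nat.exists_eq_add_of_lt hsum
  have hdR : (A.card : ℝ) + B.card = m + β + (d + 1) := by
    have : A.card + B.card = m + β + (d + 1) := by omega
    exact_mod_cast this
  have hε2 : ε ^ 2 < 1 / 16 := by nlinarith
  have key : ∀ x y : ℝ, (1 - ε ^ 2) * x < m → x + y = m + β + (d + 1) → x < m + y := by
    intro x y hx hxy
    have hε3 : ε ^ 2 ≤ ε / 4 := by nlinarith
    have h₁ : 0 ≤ ε * (1 - ε - ε ^ 2) := mul_nonneg hε₀.le (by linarith)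
    have h₂ : 0 ≤ ε * (1 - ε - ε ^ 2) * m := mul_nonneg h₁ (by linarith)
    have : (m : ℝ) ≤ (1 - ε ^ 2) * ((1 + ε) * m) := by linarith
    have : x < (1 + ε) * m := lt_of_mul_lt_mul_left (hx.trans_le this) (by linarith)
    nlinarith
  -- With excess `|A| + |B| - m - β = d + 1`, Pollard's inequality is applied at the level `t = ⌈(d
  -- + 1)/2⌉`, which maximises `t(d + 2 - t)` up to rounding.
  have htB : (d + 2) / 2 ≤ B.card := by
    have : A.card < m + B.card := by exact_mod_cast key _ _ hA hdR
    omega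
  have htA : (d + 2) / 2 ≤ A.card := by
    have : B.card < m + A.card := by
      exact_mod_cast key B.card A.card hB (by linarith)
    omega
  have hP := le_truncSum hβ hτ B.card ((d + 2) / 2) A B le_rfl htA htB
  have hT : (truncSum ((d + 2) / 2) A B : ℝ) ≤
      (missingPairs D A B).card + ((d + 2) / 2 : ℕ) * m := by
    have := truncSum_le_card_missingPairs_add ((d + 2) / 2) D A B
    exact_mod_cast this.trans (Nat.add_le_add_left (Nat.mul_le_mul_left _ hD) _)
  have ht₁ : ((d : ℝ) + 1) ≤ 2 * ((d + 2) / 2 : ℕ) := by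
    have : d + 1 ≤ 2 * ((d + 2) / 2) := by omega
    exact_mod_cast this
  have ht₂ : 2 * (((d + 2) / 2 : ℕ) : ℝ) ≤ (d : ℝ) + 2 := by
    have : 2 * ((d + 2) / 2) ≤ d + 2 := by omega
    exact_mod_cast this
  generalize (((d + 2) / 2 : ℕ) : ℝ) = t at *
  have hd₀ : (0 : ℝ) ≤ d := by positivity
  have hA₀ : (0 : ℝ) ≤ A.card := by positivity
  have hB₀ : (0 : ℝ) ≤ B.card := by positivity
  generalize (A.card : ℝ) = x at *
  generalize (B.card : ℝ) = y at *
  generalize ((missingPairs D A B).card : ℝ) = e at *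
  generalize (d : ℝ) = d at *
  generalize (m : ℝ) = m at *
  generalize (β : ℝ) = β at *
  have hdε : 2 * ε * (m + β) < d + 1 := by linarith
  -- If `τ = (1 + 4ε)m` is the minimum, then `e ≥ 4εmt ≥ 4ε²m² ≥ ε²xy`, as `x, y ≤ 2m`. Otherwise `e
  -- ≥ (d + 1)²/4 ≥ ε²(x + y)²/4 ≥ ε²xy`.
  rcases le_total ((1 + 4 * ε) * m) (x + y - t - β + 1) with hc | hc
  · rw [min_eq_left hc] at hP
    have h₁ : ε * m ≤ t := by nlinarith
    have h₂ : 4 * ε * m * t ≤ e := by linarith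
    have h₃ : 4 * ε * m * (ε * m) ≤ 4 * ε * m * t :=
      mul_le_mul_of_nonneg_left h₁ (by positivity)
    have hx : x ≤ 2 * m := by nlinarith
    have hy : y ≤ 2 * m := by nlinarith
    have h₄ : x * y ≤ (2 * m) * (2 * m) := mul_le_mul hx hy hB₀ (by linarith)
    have h₅ := mul_le_mul_of_nonneg_left h₄ (sq_nonneg ε)
    linarith
  · rw [min_eq_right hc] at hP
    have h₁ : t * (d + 2 - t) ≤ e := by
      have : x + y - t - β + 1 = m + (d + 2 - t) := by linarith
      rw [this] at hP
      linarith
    have h₂ : (d + 1) ^ 2 / 4 ≤ t * (d + 2 - t) := by nlinarith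
    have h₃ : ε * (x + y) ≤ d + 1 := by nlinarith
    have h₄ : (ε * (x + y)) ^ 2 ≤ (d + 1) ^ 2 := pow_le_pow_left₀ (by positivity) h₃ 2
    have h₅ : ε ^ 2 * x * y ≤ (ε * (x + y)) ^ 2 / 4 := by
      nlinarith [mul_nonneg (sq_nonneg ε) (sq_nonneg (x - y))]
    linarith

end Supersaturation

/-! ### Missing degrees and the drop of the potential. -/

/-- The number of elements of `F` whose sum with `x` lies outside `D`. -/
def missingDegree {G : Type*} [AddCommGroup G] [DecidableEq G] (D F : Finset G) (x : G) : ℕ :=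
  (F.filter fun f => x + f ∉ D).card

section Degrees

variable {G : Type*} [AddCommGroup G] [DecidableEq G]

theorem card_missingPairs_eq_sum (D A B : Finset G) :
    (missingPairs D A B).card = ∑ a ∈ A, missingDegree D B a := by
  simp only [missingPairs, missingDegree, Finset.card_filter, Finset.sum_product]

theorem missingDegree_le_card (D F : Finset G) (x : G) : missingDegree D F x ≤ F.card :=
  Finset.card_filter_le _ _

theorem card_union_image_add (D F : Finset G) (x : G) :
    (D ∪ F.image (x + ·)).card = D.card + missingDegree D F x := by
  rw [← Finset.union_sdiff_self_eq_union, Finset.card_union_of_disjoint Finset.disjoint_sdiff]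
  congr 1
  rw [missingDegree, ← Finset.card_image_of_injective (F.filter _) (add_right_injective x)]
  congr 1
  ext y
  simp only [Finset.mem_sdiff, Finset.mem_image, Finset.mem_filter]
  constructor
  · rintro ⟨⟨f, hf, rfl⟩, h⟩
    exact ⟨f, ⟨hf, h⟩, rfl⟩
  · rintro ⟨f, ⟨hf, h⟩, rfl⟩
    exact ⟨⟨f, hf, rfl⟩, h⟩

theorem exists_top_subset {α : Type*} [DecidableEq α] (g : α → ℕ) (A : Finset α) (q : ℕ) (hq : q ≤ A.card) :
    ∃ F ⊆ A, F.card = q ∧ ∀ x ∈ F, ∀ y ∈ A, y ∉ F → g y ≤ g x := by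
  induction q with
  | zero => exact ⟨∅, by simp, by simp, by simp⟩
  | succ q ih =>
    obtain ⟨F, hFA, hF, h⟩ := ih (by omega)
    have hne : (A \ F).Nonempty := by
      rw [← Finset.card_pos, Finset.card_sdiff_of_subset hFA]; omega
    obtain ⟨z, hz, hmax⟩ := Finset.exists_max_image (A \ F) g hne
    rw [Finset.mem_sdiff] at hz
    refine ⟨insert z F, Finset.insert_subset hz.1 hFA, ?_, ?_⟩
    · rw [Finset.card_insert_of_notMem hz.2, hF]
    · intro x hx y hy hyF
      rw [Finset.mem_insert, not_or] at hyF
      rcases Finset.mem_insert.1 hx with rfl | hx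
      · exact hmax y (Finset.mem_sdiff.2 ⟨hy, hyF.2⟩)
      · exact h x hx y hy hyF.2

/-- The average of `g` over its top part `F` is at least its average over `U`; this transfers
density from `U` to the fingerprint. -/
theorem card_mul_sum_le_of_top {α : Type*} [DecidableEq α] (g : α → ℕ) {F U : Finset α} (hFU : F ⊆ U)
    (h : ∀ x ∈ F, ∀ y ∈ U, y ∉ F → g y ≤ g x) :
    F.card * ∑ y ∈ U, g y ≤ U.card * ∑ x ∈ F, g x := by
  have key : F.card * ∑ y ∈ U \ F, g y ≤ (U \ F).card * ∑ x ∈ F, g x := by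
    rw [← smul_eq_mul, ← smul_eq_mul, ← Finset.sum_const, ← Finset.sum_const, Finset.sum_comm]
    refine Finset.sum_le_sum fun y hy => Finset.sum_le_sum fun x hx => ?_
    rw [Finset.mem_sdiff] at hy
    exact h x hx y hy.1 hy.2
  rw [← Finset.sum_sdiff hFU, ← Finset.card_sdiff_add_card_eq_card hFU]
  linarith

theorem card_missingPairs_le_add (F V : Finset G) {D D' : Finset G} :
    (missingPairs D F V).card ≤
      (missingPairs D' F V).card + F.card * (D' \ D).card := by
  refine le_trans ?_ (Nat.add_le_add_left (card_pairs_add_mem_le (D' \ D) F V) _)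
  refine le_trans (Finset.card_le_card ?_) (Finset.card_union_le _ _)
  intro p
  simp only [missingPairs, Finset.mem_union, Finset.mem_filter, Finset.mem_sdiff]
  tauto

/-- The elements of `V` of missing degree less than `θ`. -/
noncomputable def lowDegree (D F V : Finset G) (θ : ℝ) : Finset G :=
  V.filter fun b => (missingDegree D F b : ℝ) < θ

theorem lowDegree_subset (D F V : Finset G) (θ : ℝ) : lowDegree D F V θ ⊆ V :=
  Finset.filter_subset _ _

theorem card_missingPairs_lowDegree_le (D F V : Finset G) (θ : ℝ) :
    ((missingPairs D F (lowDegree D F V θ)).card : ℝ) ≤ θ * (lowDegree D F V θ).card := by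
  rw [card_missingPairs_comm, card_missingPairs_eq_sum]
  push_cast
  rw [mul_comm, ← nsmul_eq_mul]
  exact Finset.sum_le_card_nsmul _ _ _ fun b hb => (Finset.mem_filter.1 hb).2.le

theorem card_missingPairs_le_lowDegree (D F V : Finset G) (θ : ℝ) :
    ((missingPairs D F V).card : ℝ) ≤
      θ * (lowDegree D F V θ).card + F.card * (V \ lowDegree D F V θ).card := by
  refine le_trans ?_ (add_le_add_left (card_missingPairs_lowDegree_le D F V θ) _)
  rw [card_missingPairs_comm, card_missingPairs_comm D F, card_missingPairs_eq_sum,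
    card_missingPairs_eq_sum, ← Finset.sum_sdiff (lowDegree_subset D F V θ), add_comm]
  push_cast
  refine add_le_add_right ?_ _
  rw [mul_comm, ← nsmul_eq_mul]
  exact Finset.sum_le_card_nsmul _ _ _ fun b _ => by exact_mod_cast missingDegree_le_card D F b

/-- The `ε²|F||V|` missing pairs must be covered by new elements of `D`, removed elements of `V`, or
remaining pairs of low degree. The last account for at most half, so `|D|` grows or `|V|` shrinks.
The cap `2m` keeps the potential `O(m)` whatever the size of `Y`. -/
theorem potential_drop {m : ℕ} {ε : ℝ} (hε₀ : 0 < ε) (hε₁ : ε < 1 / 4)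
    {D D' F V : Finset G} (hDD : D ⊆ D') (hD' : D'.card ≤ m) (hF : 0 < F.card)
    (hV : (m : ℝ) / 4 < V.card)
    (h : ε ^ 2 * F.card * V.card ≤ (missingPairs D F V).card) :
    ((min (lowDegree D' F V (ε ^ 2 / 2 * F.card)).card (2 * m) + (m - D'.card) : ℕ) : ℝ) +
      ε ^ 2 * m / 8 ≤ (min V.card (2 * m) + (m - D.card) : ℕ) := by
  have hDc : D.card ≤ m := (Finset.card_le_card hDD).trans hD'
  have hF' : (0 : ℝ) < F.card := by exact_mod_cast hF
  push_cast [Nat.cast_sub hD', Nat.cast_sub hDc]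
  have hsub := lowDegree_subset D' F V (ε ^ 2 / 2 * F.card)
  have h₁ : ((missingPairs D F V).card : ℝ) ≤
      (missingPairs D' F V).card + F.card * (D' \ D).card := by
    exact_mod_cast card_missingPairs_le_add F V
  have h₂ := card_missingPairs_le_lowDegree D' F V (ε ^ 2 / 2 * F.card)
  have h₃ := card_missingPairs_lowDegree_le D' F V (ε ^ 2 / 2 * F.card)
  have h₄ : (F.card : ℝ) * (lowDegree D' F V (ε ^ 2 / 2 * F.card)).card ≤
      (missingPairs D' F (lowDegree D' F V (ε ^ 2 / 2 * F.card))).card + F.card * D'.card := by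
    exact_mod_cast mul_card_le_card_missingPairs_add _ _ _
  generalize lowDegree D' F V (ε ^ 2 / 2 * F.card) = V' at *
  have e₁ : ((V \ V').card : ℝ) = V.card - V'.card := by
    rw [eq_sub_iff_add_eq]; exact_mod_cast Finset.card_sdiff_add_card_eq_card hsub
  have e₂ : ((D' \ D).card : ℝ) = D'.card - D.card := by
    rw [eq_sub_iff_add_eq]; exact_mod_cast Finset.card_sdiff_add_card_eq_card hDD
  have hVV : (V'.card : ℝ) ≤ V.card := by exact_mod_cast Finset.card_le_card hsub
  have hDD' : (D.card : ℝ) ≤ D'.card := by exact_mod_cast Finset.card_le_card hDD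
  have hD'm : (D'.card : ℝ) ≤ m := by exact_mod_cast hD'
  rw [e₁] at h₂
  rw [e₂] at h₁
  have hε2 : ε ^ 2 < 1 / 16 := by nlinarith
  have hm₀ : (0 : ℝ) ≤ m := by positivity
  have hV₀ : (0 : ℝ) ≤ V'.card := by positivity
  have hεpos : 0 < ε ^ 2 := by positivity
  have k₁ : ε ^ 2 * V.card ≤ ε ^ 2 / 2 * V'.card + (V.card - V'.card) + (D'.card - D.card) := by
    refine le_of_mul_le_mul_left ?_ hF'
    linarith
  have k₂ : (V'.card : ℝ) ≤ ε ^ 2 / 2 * V'.card + D'.card := by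
    refine le_of_mul_le_mul_left ?_ hF'
    linarith
  generalize (V.card : ℝ) = v at *
  generalize (V'.card : ℝ) = v' at *
  generalize (D.card : ℝ) = d at *
  generalize (D'.card : ℝ) = d' at *
  generalize (m : ℝ) = m at *
  generalize ε ^ 2 = δ at *
  have k₃ : δ * m ≤ m / 16 := by nlinarith
  rcases le_total v (2 * m) with hc | hc
  · rw [min_eq_left hc]
    have := min_le_left v' (2 * m)
    have k₄ : δ * v' ≤ δ * v := mul_le_mul_of_nonneg_left hVV hεpos.le
    have k₅ : δ * (m / 4) ≤ δ * v := mul_le_mul_of_nonneg_left hV.le hεpos.le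
    linarith
  -- By `k₂`, `v'` barely exceeds `m`: nearly all of `F × V'` has its sum in `D'`. The capped size
  -- thus falls from `2m` by almost `m`.
  · rw [min_eq_right hc]
    have := min_le_left v' (2 * m)
    have k₄ : δ * v' ≤ 1 / 16 * v' := mul_le_mul_of_nonneg_right hε2.le hV₀
    linarith

end Degrees

/-! ### The container algorithm. -/

/-- A container triple `(D, U, V)`: sets `U, V ⊆ Y` and a set `D` of at most `m` forced sums such
that `U` and `V` are small or few pairs in `U × V` have their sum outside `D`. -/
structure IsContainer {G : Type*} [AddCommGroup G] [DecidableEq G] (m : ℕ) (ε : ℝ) (Y : Finset G)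
    (T : Finset G × Finset G × Finset G) : Prop where
  card_le : T.1.card ≤ m
  left_subset : T.2.1 ⊆ Y
  right_subset : T.2.2 ⊆ Y
  sparse : ((T.2.1.card : ℝ) ≤ m / 4 ∧ (T.2.2.card : ℝ) ≤ m / 4) ∨
    ((missingPairs T.1 T.2.1 T.2.2).card : ℝ) < ε ^ 2 * T.2.1.card * T.2.2.card

/-- At most `N` container triples suffice for all pairs `(A, B)` satisfying `P`. -/
def IsCoverable {G : Type*} [AddCommGroup G] [DecidableEq G] (m : ℕ) (ε : ℝ) (Y : Finset G)
    (P : Finset G → Finset G → Prop) (N : ℝ) : Prop :=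
  ∃ 𝒞 : Finset (Finset G × Finset G × Finset G), (𝒞.card : ℝ) ≤ N ∧
    (∀ T ∈ 𝒞, IsContainer m ε Y T) ∧
    ∀ A B, P A B → ∃ T ∈ 𝒞, T.1 ⊆ A + B ∧ A ⊆ T.2.1 ∧ B ⊆ T.2.2

/-- The pairs `(A, B)` in `U × V` with small sumset which contains `D`. -/
structure IsCompatible {G : Type*} [AddCommGroup G] [DecidableEq G] (m q : ℕ)
    (D U V A B : Finset G) : Prop where
  left_subset : A ⊆ U
  right_subset : B ⊆ V
  subset_add : D ⊆ A + B
  le_card_left : q ≤ A.card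
  le_card_right : q ≤ B.card
  card_add_le : (A + B).card ≤ m

section Containers

variable {G : Type*} [AddCommGroup G] [DecidableEq G] {m q : ℕ} {ε : ℝ} {Y : Finset G}
  {P Q : Finset G → Finset G → Prop} {N M : ℝ}

theorem IsContainer.swap {T : Finset G × Finset G × Finset G} (h : IsContainer m ε Y T) :
    IsContainer m ε Y (T.1, T.2.2, T.2.1) where
  card_le := h.card_le
  left_subset := h.right_subset
  right_subset := h.left_subset
  sparse := by
    refine h.sparse.imp And.symm fun h' => ?_
    rw [card_missingPairs_comm]
    exact h'.trans_eq (by ring)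

theorem IsCoverable.mono (h : IsCoverable m ε Y P N) (hQ : ∀ A B, Q A B → P A B) (hN : N ≤ M) :
    IsCoverable m ε Y Q M := by
  obtain ⟨𝒞, h₁, h₂, h₃⟩ := h
  exact ⟨𝒞, h₁.trans hN, h₂, fun A B h => h₃ A B (hQ A B h)⟩

theorem isCoverable_of_forall_not (hN : 0 ≤ N) (h : ∀ A B, ¬ P A B) : IsCoverable m ε Y P N :=
  ⟨∅, by simpa using hN, by simp, fun A B hP => absurd hP (h A B)⟩

theorem isCoverable_of_isContainer {T : Finset G × Finset G × Finset G} (hN : 1 ≤ N)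
    (hT : IsContainer m ε Y T)
    (h : ∀ A B, P A B → T.1 ⊆ A + B ∧ A ⊆ T.2.1 ∧ B ⊆ T.2.2) : IsCoverable m ε Y P N :=
  ⟨{T}, by simpa using hN, by simpa using hT, fun A B hP => ⟨T, by simp, h A B hP⟩⟩

theorem IsCoverable.swap (h : IsCoverable m ε Y P N) :
    IsCoverable m ε Y (fun A B => P B A) N := by
  obtain ⟨𝒞, h₁, h₂, h₃⟩ := h
  refine ⟨𝒞.image fun T => (T.1, T.2.2, T.2.1), ?_, ?_, fun A B hP => ?_⟩
  · exact le_trans (by exact_mod_cast Finset.card_image_le) h₁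
  · intro T hT
    obtain ⟨T', hT', rfl⟩ := Finset.mem_image.1 hT
    exact (h₂ T' hT').swap
  · obtain ⟨T, hT, hD, hB, hA⟩ := h₃ B A hP
    exact ⟨_, Finset.mem_image_of_mem _ hT, by rwa [add_comm A B], hA, hB⟩

theorem IsCoverable.or (hP : IsCoverable m ε Y P N) (hQ : IsCoverable m ε Y Q M) :
    IsCoverable m ε Y (fun A B => P A B ∨ Q A B) (N + M) := by
  obtain ⟨𝒞, h₁, h₂, h₃⟩ := hP
  obtain ⟨𝒟, k₁, k₂, k₃⟩ := hQ
  refine ⟨𝒞 ∪ 𝒟, ?_, fun T hT => ?_, ?_⟩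
  · have : ((𝒞 ∪ 𝒟).card : ℝ) ≤ 𝒞.card + 𝒟.card := by exact_mod_cast Finset.card_union_le _ _
    linarith
  · exact (Finset.mem_union.1 hT).elim (h₂ T) (k₂ T)
  · rintro A B (h | h)
    · obtain ⟨T, hT, hh⟩ := h₃ A B h
      exact ⟨T, Finset.mem_union_left _ hT, hh⟩
    · obtain ⟨T, hT, hh⟩ := k₃ A B h
      exact ⟨T, Finset.mem_union_right _ hT, hh⟩

theorem isCoverable_exists {ι : Type*} (s : Finset ι) {R : ι → Finset G → Finset G → Prop}
    (h : ∀ i ∈ s, IsCoverable m ε Y (R i) N) :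
    IsCoverable m ε Y (fun A B => ∃ i ∈ s, R i A B) (s.card * N) := by
  choose! 𝒞 h₁ h₂ h₃ using h
  refine ⟨s.biUnion 𝒞, ?_, fun T hT => ?_, ?_⟩
  · have h₄ : ((s.biUnion 𝒞).card : ℝ) ≤ ∑ i ∈ s, ((𝒞 i).card : ℝ) := by
      exact_mod_cast Finset.card_biUnion_le
    refine h₄.trans ?_
    rw [← nsmul_eq_mul]
    exact Finset.sum_le_card_nsmul _ _ _ h₁
  · obtain ⟨i, hi, hT⟩ := Finset.mem_biUnion.1 hT
    exact h₂ i hi T hT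
  · rintro A B ⟨i, hi, h⟩
    obtain ⟨T, hT, hh⟩ := h₃ i hi A B h
    exact ⟨T, Finset.mem_biUnion.2 ⟨i, hi, hT⟩, hh⟩

theorem IsCompatible.swap {D U V A B : Finset G} (h : IsCompatible m q D U V A B) :
    IsCompatible m q D V U B A :=
  ⟨h.right_subset, h.left_subset, by rw [add_comm B A]; exact h.subset_add, h.le_card_right,
    h.le_card_left, by rw [add_comm B A]; exact h.card_add_le⟩

/-- For `F ⊆ A`, adding to `D` the translates `b + F`, `b ∈ B`, which contribute many new sums,
until all elements of `B` have low degree. -/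
theorem isCoverable_of_lowDegree {n : ℕ} (hn : 2 ≤ n) (hY : Y.card = n) {F W V D₀ : Finset G}
    (hV : V ⊆ Y) {θ c X : ℝ} (hθ : 0 < θ) (hc : 0 ≤ c) (hcθ : 2 ≤ c * θ)
    (hleaf : ∀ D, D₀ ⊆ D → D.card ≤ m → IsCoverable m ε Y
      (IsCompatible m q D W (lowDegree D F V θ)) ((n : ℝ) ^ (X + c * ((m : ℝ) - D.card)))) (k : ℕ) :
    ∀ D, D₀ ⊆ D → D.card ≤ m → m - D.card ≤ k → IsCoverable m ε Y
      (fun A B => F ⊆ A ∧ IsCompatible m q D W V A B)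
      ((n : ℝ) ^ (2 + X + c * ((m : ℝ) - D.card))) := by
  have hn₁ : (1 : ℝ) ≤ n := by exact_mod_cast (by omega : 1 ≤ n)
  have hn₀ : (0 : ℝ) < n := by linarith
  induction k using Nat.strong_induction_on with
  | _ k ih =>
    intro D hD₀ hDm hk
    set K : ℝ := (n : ℝ) ^ (X + c * ((m : ℝ) - D.card)) with hK
    have hK₀ : 0 < K := Real.rpow_pos_of_pos hn₀ _
    have hstep : ∀ b ∈ Y, IsCoverable m ε Y (fun A B => θ ≤ missingDegree D F b ∧ b ∈ B ∧ F ⊆ A ∧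
        IsCompatible m q D W V A B) K := by
      intro b _
      by_cases hb : θ ≤ missingDegree D F b
      swap
      · exact isCoverable_of_forall_not hK₀.le fun A B h => hb h.1
      have hsub : ∀ A B, b ∈ B → F ⊆ A → D ⊆ A + B → D ∪ F.image (b + ·) ⊆ A + B := by
        intro A B hbB hFA hDAB
        refine Finset.union_subset hDAB fun x hx => ?_
        obtain ⟨f, hf, rfl⟩ := Finset.mem_image.1 hx
        rw [add_comm b f]
        exact Finset.add_mem_add (hFA hf) hbB
      have hcard := card_union_image_add D F b
      by_cases hm : (D ∪ F.image (b + ·)).card ≤ m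
      swap
      · refine isCoverable_of_forall_not hK₀.le fun A B h => hm ?_
        exact (Finset.card_le_card (hsub A B h.2.1 h.2.2.1 h.2.2.2.subset_add)).trans
          h.2.2.2.card_add_le
      have hpos : 0 < missingDegree D F b := by
        have : (0 : ℝ) < missingDegree D F b := hθ.trans_le hb
        exact_mod_cast this
      refine (ih (m - (D ∪ F.image (b + ·)).card) (by omega) _
        (hD₀.trans Finset.subset_union_left) hm le_rfl).mono ?_ ?_
      · rintro A B ⟨-, hbB, hFA, h⟩
        exact ⟨hFA, { h with subset_add := hsub A B hbB hFA h.subset_add }⟩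
      · refine Real.rpow_le_rpow_of_exponent_le hn₁ ?_
        rw [hcard]
        push_cast
        have := mul_le_mul_of_nonneg_left hb hc
        linarith
    refine ((hleaf D hD₀ hDm).or (isCoverable_exists Y hstep)).mono ?_ ?_
    · rintro A B ⟨hFA, h⟩
      by_cases hB : ∀ b ∈ B, (missingDegree D F b : ℝ) < θ
      · exact Or.inl { h with
          right_subset := fun b hb => Finset.mem_filter.2 ⟨h.right_subset hb, hB b hb⟩ }
      · push Not at hB
        obtain ⟨b, hb, hθb⟩ := hB
        exact Or.inr ⟨b, hV (h.right_subset hb), hθb, hb, hFA, h⟩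
    -- One leaf and `n` branches give the factor `1 + n ≤ n²`, hence the `2` in the exponent. A
    -- branch enlarges `D` by at least `θ`, and `cθ ≥ 2` pays for that `2` at the next level.
    · rw [hY, ← hK, add_assoc, Real.rpow_add hn₀, ← hK, Real.rpow_two]
      have : (2 : ℝ) ≤ n := by exact_mod_cast hn
      have hn2 : 1 + (n : ℝ) ≤ n ^ 2 := by nlinarith
      have := mul_le_mul_of_nonneg_right hn2 hK₀.le
      linarith

/-- The potential of `(D, U, V)`. -/
def potential {α : Type*} (m : ℕ) (D U V : Finset α) : ℕ :=
  min U.card (2 * m) + min V.card (2 * m) + (m - D.card)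

theorem potential_comm {α : Type*} (m : ℕ) (D U V : Finset α) : potential m D U V = potential m D V U := by
  rw [potential, potential, add_comm (min U.card _)]

/-- One round of the container algorithm: the fingerprint `F` consists of `q` elements of `A` of
largest degree. -/
theorem isCoverable_round {n : ℕ} (hn : 2 ≤ n) (hY : Y.card = n) (hε₀ : 0 < ε) (hε₁ : ε < 1 / 4)
    (hm : 1 ≤ m) (hq : 0 < q) {c₁ c₂ : ℝ} (hc₁ : 0 ≤ c₁) (hc₂ : 0 ≤ c₂)
    (hcq₁ : (q : ℝ) + 2 ≤ c₁ * (ε ^ 2 * m / 8)) (hcq₂ : 2 ≤ c₂ * (ε ^ 2 / 2 * q))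
    {D U V : Finset G} (hU : U ⊆ Y) (hV : V ⊆ Y) (hD : D.card ≤ m) (hVm : (m : ℝ) / 4 < V.card)
    (ih : ∀ D' U' V' : Finset G, U' ⊆ Y → V' ⊆ Y → D'.card ≤ m →
      (potential m D' U' V' : ℝ) + ε ^ 2 * m / 8 ≤ potential m D U V →
      IsCoverable m ε Y (IsCompatible m q D' U' V')
        ((n : ℝ) ^ (c₁ * potential m D' U' V' + c₂ * ((m : ℝ) - D'.card)))) :
    IsCoverable m ε Y (IsCompatible m q D U V)
      ((n : ℝ) ^ (c₁ * potential m D U V + c₂ * ((m : ℝ) - D.card))) := by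
  have hn₁ : (1 : ℝ) ≤ n := by exact_mod_cast (by omega : 1 ≤ n)
  have hn₀ : (0 : ℝ) < n := by linarith
  have hm' : (1 : ℝ) ≤ m := by exact_mod_cast hm
  have hDm : (0 : ℝ) ≤ (m : ℝ) - D.card := sub_nonneg.2 (by exact_mod_cast hD)
  -- What `U` can still contribute once `F` is known to be the `q` elements of `A` of largest
  -- degree: it contains `A`, and `F` is its top part.
  let top : Finset G → Finset G := fun F =>
    U.filter fun y => y ∈ F ∨ ∀ x ∈ F, missingDegree D V y ≤ missingDegree D V x
  have htopU : ∀ F, top F ⊆ U := fun F => Finset.filter_subset _ _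
  have hpot : ε ^ 2 * m / 8 ≤ (potential m D U V : ℝ) := by
    have h₁ : ((min V.card (2 * m) : ℕ) : ℝ) ≤ potential m D U V := by
      exact_mod_cast (by rw [potential]; omega : min V.card (2 * m) ≤ potential m D U V)
    refine le_trans ?_ h₁
    push_cast
    have : ε ^ 2 * m ≤ 1 * m := mul_le_mul_of_nonneg_right (by nlinarith) (by linarith)
    exact le_min (by linarith) (by linarith)
  have hmain : ∀ F ∈ U.powersetCard q, IsCoverable m ε Y
      (fun A B => F ⊆ A ∧ IsCompatible m q D (top F) V A B)
      ((n : ℝ) ^ (c₁ * potential m D U V - q + c₂ * ((m : ℝ) - D.card))) := by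
    intro F hF
    rw [Finset.mem_powersetCard] at hF
    have hFtop : F ⊆ top F := fun x hx => Finset.mem_filter.2 ⟨hF.1 hx, Or.inl hx⟩
    have hc := mul_le_mul_of_nonneg_left hpot hc₁
    by_cases hdense :
        ε ^ 2 * (top F).card * V.card ≤ ((missingPairs D (top F) V).card : ℝ)
    swap
    · refine isCoverable_of_isContainer (T := (D, top F, V)) ?_
        ⟨hD, (htopU F).trans hU, hV, Or.inr (not_le.1 hdense)⟩
        fun A B h => ⟨h.2.subset_add, h.2.left_subset, h.2.right_subset⟩
      refine Real.one_le_rpow hn₁ ?_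
      have := mul_nonneg hc₂ hDm
      linarith
    have htop : F.card * (missingPairs D (top F) V).card ≤
        (top F).card * (missingPairs D F V).card := by
      rw [card_missingPairs_eq_sum, card_missingPairs_eq_sum]
      refine card_mul_sum_le_of_top _ hFtop fun x hx y hy hyF => ?_
      exact (Finset.mem_filter.1 hy).2.resolve_left hyF x hx
    have hFpos : 0 < F.card := by omega
    have htpos : (0 : ℝ) < (top F).card := by
      exact_mod_cast hFpos.trans_le (Finset.card_le_card hFtop)
    have hF' : ε ^ 2 * F.card * V.card ≤ ((missingPairs D F V).card : ℝ) := by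
      refine le_of_mul_le_mul_left ?_ htpos
      have h₁ : (F.card : ℝ) * (missingPairs D (top F) V).card ≤
        (top F).card * (missingPairs D F V).card := by exact_mod_cast htop
      have h₂ := mul_le_mul_of_nonneg_left hdense (Nat.cast_nonneg (α := ℝ) F.card)
      linarith
    have hqF : (F.card : ℝ) = q := by exact_mod_cast hF.2
    have hθ : 0 < ε ^ 2 / 2 * (F.card : ℝ) := by
      have : (0 : ℝ) < F.card := by exact_mod_cast hFpos
      positivity
    -- `X` carries the potential after the drop. The amount `c₁ε²m/8 ≥ q + 2` saved pays for the
    -- `n^q` choices of `F` and the factor `n²` of the growth of `D`.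
    refine (isCoverable_of_lowDegree (D₀ := D) (X := c₁ * (potential m D U V - ε ^ 2 * m / 8))
      hn hY hV hθ hc₂ (by rwa [hqF]) ?_ (m - D.card) D subset_rfl hD le_rfl).mono
      (fun A B h => h) ?_
    · intro D' hDD' hD'
      have hdrop := potential_drop hε₀ hε₁ hDD' hD' hFpos hVm hF'
      have hdrop' : (potential m D' (top F) (lowDegree D' F V (ε ^ 2 / 2 * F.card)) : ℝ) +
          ε ^ 2 * m / 8 ≤ potential m D U V := by
        have h₁ : ((min (top F).card (2 * m) : ℕ) : ℝ) ≤ (min U.card (2 * m) : ℕ) := by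
          exact_mod_cast min_le_min (Finset.card_le_card (htopU F)) le_rfl
        rw [potential, potential, add_assoc, add_assoc, Nat.cast_add, Nat.cast_add (min U.card _)]
        linarith
      refine (ih D' (top F) _ ((htopU F).trans hU) ((lowDegree_subset _ _ _ _).trans hV) hD'
        hdrop').mono (fun A B h => h) ?_
      refine Real.rpow_le_rpow_of_exponent_le hn₁ ?_
      have := mul_le_mul_of_nonneg_left (le_sub_iff_add_le.2 hdrop') hc₁
      linarith
    · refine Real.rpow_le_rpow_of_exponent_le hn₁ ?_
      linarith
  refine (isCoverable_exists (U.powersetCard q) hmain).mono ?_ ?_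
  · intro A B h
    obtain ⟨F, hFA, hFq, hF⟩ := exists_top_subset (missingDegree D V) A q h.le_card_left
    refine ⟨F, Finset.mem_powersetCard.2 ⟨hFA.trans h.left_subset, hFq⟩, hFA,
      { h with left_subset := fun y hy => Finset.mem_filter.2 ⟨h.left_subset hy, ?_⟩ }⟩
    by_cases hyF : y ∈ F
    · exact Or.inl hyF
    · exact Or.inr fun x hx => hF x hx y hy hyF
  · have h₁ : ((U.powersetCard q).card : ℝ) ≤ (n : ℝ) ^ (q : ℝ) := by
      rw [Real.rpow_natCast, Finset.card_powersetCard]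
      exact_mod_cast (Nat.choose_le_pow _ _).trans
        (Nat.pow_le_pow_left ((Finset.card_le_card hU).trans hY.le) q)
    refine (mul_le_mul_of_nonneg_right h₁ (Real.rpow_nonneg hn₀.le _)).trans ?_
    rw [← Real.rpow_add hn₀]
    exact (congrArg _ (by ring)).le

/-- Rounds are iterated by induction on the potential, refining whichever side is allowed: a round
needs the set opposite the fingerprint to exceed `m/4`, so the roles of `U` and `V` are exchanged
when `V` is small. -/
theorem isCoverable_isCompatible {n : ℕ} (hn : 2 ≤ n) (hY : Y.card = n) (hε₀ : 0 < ε)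
    (hε₁ : ε < 1 / 4) (hm : 1 ≤ m) (hq : 0 < q) {c₁ c₂ : ℝ} (hc₁ : 0 ≤ c₁) (hc₂ : 0 ≤ c₂)
    (hcq₁ : (q : ℝ) + 2 ≤ c₁ * (ε ^ 2 * m / 8)) (hcq₂ : 2 ≤ c₂ * (ε ^ 2 / 2 * q)) (k : ℕ) :
    ∀ D U V : Finset G, U ⊆ Y → V ⊆ Y → D.card ≤ m → potential m D U V ≤ k →
      IsCoverable m ε Y (IsCompatible m q D U V)
        ((n : ℝ) ^ (c₁ * potential m D U V + c₂ * ((m : ℝ) - D.card))) := by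
  have hn₁ : (1 : ℝ) ≤ n := by exact_mod_cast (by omega : 1 ≤ n)
  induction k using Nat.strong_induction_on with
  | _ k ih =>
    intro D U V hU hV hD hk
    have hlt : ∀ D' U' V' : Finset G,
        (potential m D' U' V' : ℝ) + ε ^ 2 * m / 8 ≤ potential m D U V →
        potential m D' U' V' < k := by
      intro D' U' V' h
      have : (1 : ℝ) ≤ m := by exact_mod_cast hm
      have : (0 : ℝ) < ε ^ 2 * m / 8 := by positivity
      have : (potential m D' U' V' : ℝ) < potential m D U V := by linarith
      exact lt_of_lt_of_le (by exact_mod_cast this) hk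
    by_cases hVm : (m : ℝ) / 4 < V.card
    · exact isCoverable_round hn hY hε₀ hε₁ hm hq hc₁ hc₂ hcq₁ hcq₂ hU hV hD hVm
        fun D' U' V' hU' hV' hD' h =>
          ih _ (hlt D' U' V' h) D' U' V' hU' hV' hD' le_rfl
    by_cases hUm : (m : ℝ) / 4 < U.card
    · rw [potential_comm]
      refine (isCoverable_round hn hY hε₀ hε₁ hm hq hc₁ hc₂ hcq₁ hcq₂ hV hU hD hUm
        fun D' U' V' hU' hV' hD' h => ?_).swap.mono (fun A B h => h.swap) le_rfl
      rw [potential_comm m D V U] at h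
      exact ih _ (hlt D' U' V' h) D' U' V' hU' hV' hD' le_rfl
    · refine isCoverable_of_isContainer (T := (D, U, V)) ?_
        ⟨hD, hU, hV, Or.inl ⟨not_lt.1 hUm, not_lt.1 hVm⟩⟩
        fun A B h => ⟨h.subset_add, h.left_subset, h.right_subset⟩
      refine Real.one_le_rpow hn₁ ?_
      have hDm : (0 : ℝ) ≤ (m : ℝ) - D.card := sub_nonneg.2 (by exact_mod_cast hD)
      positivity

/-- Containers for pairs of sets of at least `√m` elements whose sumset has at most `m` elements. -/
theorem isCoverable_sqrt {n : ℕ} (hn : 2 ≤ n) (hY : Y.card = n) (hε₀ : 0 < ε) (hε₁ : ε < 1 / 4)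
    (hm : 17 ≤ √(m : ℝ)) :
    IsCoverable m ε Y (IsCompatible m ⌈√(m : ℝ)⌉₊ ∅ Y Y)
      ((n : ℝ) ^ ((2 : ℝ) ^ 7 * (ε ^ 2)⁻¹ * √(m : ℝ))) := by
  have hn₁ : (1 : ℝ) ≤ n := by exact_mod_cast (by omega : 1 ≤ n)
  have hsq : √(m : ℝ) * √(m : ℝ) = m := Real.mul_self_sqrt (by positivity)
  have hm₁ : 1 ≤ m := by
    have : (1 : ℝ) ≤ m := by nlinarith
    exact_mod_cast this
  have hq₁ := Nat.le_ceil √(m : ℝ)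
  have hq₂ : (⌈√(m : ℝ)⌉₊ : ℝ) ≤ √(m : ℝ) + 1 := (Nat.ceil_lt_add_one (by positivity)).le
  have hq₀ : 0 < ⌈√(m : ℝ)⌉₊ := Nat.ceil_pos.2 (by linarith)
  have hε2 : 0 < ε ^ 2 := by positivity
  have hs : 0 < √(m : ℝ) := by linarith
  have hpot : potential m ∅ Y Y ≤ 5 * m := by
    rw [potential]; omega
  have hpot' : (potential m ∅ Y Y : ℝ) ≤ 5 * m := by exact_mod_cast hpot
  -- `c₁` makes `c₁ε²m/8 = 2√m ≥ q + 2`, and `c₂` makes `c₂ε²q/2 ≥ 2`. As the initial potential is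
  -- at most `5m`, the exponent is at most `(80 + 4)√m/ε²`, below `2⁷√m/ε²`.
  have h := isCoverable_isCompatible (c₁ := 16 * (ε ^ 2)⁻¹ * (√(m : ℝ))⁻¹)
    (c₂ := 4 * (ε ^ 2)⁻¹ * (√(m : ℝ))⁻¹) hn hY hε₀ hε₁ hm₁ hq₀ (by positivity) (by positivity)
    ?_ ?_ (potential m ∅ Y Y) ∅ Y Y subset_rfl subset_rfl (by simp) le_rfl
  · refine h.mono (fun A B h => h) (Real.rpow_le_rpow_of_exponent_le hn₁ ?_)
    have hmul : (√(m : ℝ))⁻¹ * m = √(m : ℝ) := by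
      rw [inv_mul_eq_div, Real.div_sqrt]
    have h₁ : 16 * (ε ^ 2)⁻¹ * (√(m : ℝ))⁻¹ * (potential m ∅ Y Y : ℝ) ≤
        16 * (ε ^ 2)⁻¹ * (√(m : ℝ))⁻¹ * (5 * m) :=
      mul_le_mul_of_nonneg_left hpot' (by positivity)
    have h₂ : 16 * (ε ^ 2)⁻¹ * (√(m : ℝ))⁻¹ * (5 * m) = 80 * (ε ^ 2)⁻¹ * √(m : ℝ) := by
      linear_combination 80 * (ε ^ 2)⁻¹ * hmul
    have h₃ : 4 * (ε ^ 2)⁻¹ * (√(m : ℝ))⁻¹ * (m - (∅ : Finset G).card) =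
        4 * (ε ^ 2)⁻¹ * √(m : ℝ) := by
      rw [Finset.card_empty, Nat.cast_zero]
      linear_combination 4 * (ε ^ 2)⁻¹ * hmul
    rw [h₃]
    have h₄ : 0 ≤ (ε ^ 2)⁻¹ * √(m : ℝ) := by positivity
    norm_num
    linarith
  · have : 16 * (ε ^ 2)⁻¹ * (√(m : ℝ))⁻¹ * (ε ^ 2 * m / 8) = 2 * √(m : ℝ) := by
      nth_rw 2 [← hsq]; field_simp; norm_num
    rw [this]
    linarith
  · have h₁ : 4 * (ε ^ 2)⁻¹ * (√(m : ℝ))⁻¹ * (ε ^ 2 / 2 * √(m : ℝ)) = 2 := by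
      field_simp; norm_num
    refine h₁.symm.le.trans ?_
    gcongr

theorem sumHypergraphEdges_sdiff {D U V : Finset G} (hU : U ⊆ Y) (hV : V ⊆ Y) :
    sumHypergraphEdges ((Y + Y) \ D) U V = (missingPairs D U V).card := by
  rw [sumHypergraphEdges_eq_card, missingPairs]
  congr 1
  refine Finset.filter_congr fun p hp => ?_
  rw [Finset.mem_product] at hp
  simp [Finset.add_mem_add (hU hp.1) (hV hp.2)]

end Containers

/-! ### The main theorem. -/

theorem theorem1p8 {G : Type*} [AddCommGroup G] [DecidableEq G]
    (n m : ℕ) (hn : 1 ≤ n) (hm : 1 ≤ m) (ε : ℝ) (hε₀ : 0 < ε) (hε₁ : ε < 1 / 4)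
    (Y : Finset G) (hY : Y.card = n) :
    ∃ 𝒞 : Finset (Finset G × Finset G × Finset G),
      (∀ C₀ C₁ C₂ : Finset G, (C₀, C₁, C₂) ∈ 𝒞 → C₀ ⊆ Y + Y ∧ C₁ ⊆ Y ∧ C₂ ⊆ Y) ∧
      (𝒞.card : ℝ) ≤ (n : ℝ) ^ ((2 : ℝ) ^ 7 * (ε ^ 2)⁻¹ * √(m : ℝ)) ∧
      (∀ A B : Finset G, A ⊆ Y → B ⊆ Y →
        √(m : ℝ) ≤ (A.card : ℝ) → (1 + (ε ^ 2)⁻¹) * √(m : ℝ) ≤ (B.card : ℝ) →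
        (A + B).card ≤ m →
        ∃ C₀ C₁ C₂ : Finset G, (C₀, C₁, C₂) ∈ 𝒞 ∧
          (Y + Y) \ (A + B) ⊆ C₀ ∧ A ⊆ C₁ ∧ B ⊆ C₂) ∧
      (∀ C₀ C₁ C₂ : Finset G, (C₀, C₁, C₂) ∈ 𝒞 →
        (C₁.card : ℝ) + (C₂.card : ℝ) ≤
            (1 + 2 * ε) * ((m : ℝ) + (betaG G ((1 + 4 * ε) * (m : ℝ)) : ℝ)) ∧
          (((C₁.card : ℝ) ≤ (m : ℝ) / 4 ∧ (C₂.card : ℝ) ≤ (m : ℝ) / 4) ∨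
            (sumHypergraphEdges C₀ C₁ C₂ : ℝ) < ε ^ 2 * (C₁.card : ℝ) * (C₂.card : ℝ))) := by
  by_cases hpairs : 2 ≤ n ∧ 17 ≤ √(m : ℝ)
  swap
  -- No pair is admissible here: `ε⁻² ≥ 16` gives `17√m ≤ |B| ≤ |A + B| ≤ m`, hence `√m ≥ 17` and `n
  -- ≥ |B| ≥ 2`. The empty collection therefore suffices.
  · refine ⟨∅, by simp, by simpa using Real.rpow_nonneg (Nat.cast_nonneg n) _, ?_, by simp⟩
    intro A B hA hB hAc hBc hAB
    refine absurd ?_ hpairs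
    have hsq : √(m : ℝ) * √(m : ℝ) = m := Real.mul_self_sqrt (by positivity)
    have hm' : (1 : ℝ) ≤ m := by exact_mod_cast hm
    have hs : 1 ≤ √(m : ℝ) := Real.one_le_sqrt.2 hm'
    have hε : 16 ≤ (ε ^ 2)⁻¹ := by
      rw [le_inv_comm₀ (by norm_num) (by positivity)]
      nlinarith
    have hBs : 17 * √(m : ℝ) ≤ B.card := le_trans (by gcongr; linarith) hBc
    have hAne : A.Nonempty := by
      rw [← Finset.card_pos]
      have : (0 : ℝ) < A.card := by linarith
      exact_mod_cast this
    have hBm : (B.card : ℝ) ≤ m := by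
      exact_mod_cast (Finset.card_le_card_add_left hAne).trans hAB
    refine ⟨?_, by nlinarith⟩
    have : (2 : ℝ) ≤ B.card := by linarith
    exact le_trans (by exact_mod_cast this) ((Finset.card_le_card hB).trans hY.le)
  obtain ⟨𝒟, hcard, hcont, hcov⟩ := isCoverable_sqrt (Y := Y) hpairs.1 hY hε₀ hε₁ hpairs.2
  refine ⟨𝒟.image fun T => ((Y + Y) \ T.1, T.2.1, T.2.2), ?_, ?_, ?_, ?_⟩
  · intro C₀ C₁ C₂ hC
    obtain ⟨T, hT, h⟩ := Finset.mem_image.1 hC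
    obtain ⟨rfl, rfl, rfl⟩ : _ ∧ _ ∧ _ := by simpa only [Prod.mk.injEq] using h
    exact ⟨Finset.sdiff_subset, (hcont T hT).left_subset, (hcont T hT).right_subset⟩
  · exact le_trans (by exact_mod_cast Finset.card_image_le) hcard
  · intro A B hA hB hAc hBc hAB
    have hBc' : √(m : ℝ) ≤ B.card := by
      refine le_trans ?_ hBc
      have : 0 ≤ (ε ^ 2)⁻¹ * √(m : ℝ) := by positivity
      linarith
    obtain ⟨T, hT, hD, hAT, hBT⟩ := hcov A B
      ⟨hA, hB, Finset.empty_subset _, Nat.ceil_le.2 hAc, Nat.ceil_le.2 hBc', hAB⟩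
    exact ⟨_, _, _, Finset.mem_image_of_mem _ hT, Finset.sdiff_subset_sdiff subset_rfl hD, hAT, hBT⟩
  · intro C₀ C₁ C₂ hC
    obtain ⟨T, hT, h⟩ := Finset.mem_image.1 hC
    obtain ⟨rfl, rfl, rfl⟩ : _ ∧ _ ∧ _ := by simpa only [Prod.mk.injEq] using h
    have hT' := hcont T hT
    rw [sumHypergraphEdges_sdiff hT'.left_subset hT'.right_subset]
    refine ⟨?_, hT'.sparse⟩
    rcases hT'.sparse with h | h
    · have hm' : (0 : ℝ) ≤ m := by positivity
      have hβ : (0 : ℝ) ≤ betaG G ((1 + 4 * ε) * (m : ℝ)) := by positivity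
      have : 0 ≤ ε * (m + betaG G ((1 + 4 * ε) * (m : ℝ))) := by positivity
      linarith [h.1, h.2]
    · exact card_add_card_le_of_card_missingPairs_lt hm hε₀ hε₁ hT'.card_le h
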